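/- Let $R=\mathbb{F}_2\langle a,x : a=a^2x\rangle$ be the unital associative $\mathbb{F}_2$-algebra with generators $a,x$ and the single relation $a=a^2x$. Call a word in the letters $a,x$ reduced if it does not contain $aax$ as a block of consecutive letters; the reduced words (including the empty word $1$) form an $\mathbb{F}_2$-basis of $R$, and the support $\operatorname{supp}(f)$ of $f\in R$ is the set of reduced words whose coefficient in $f$ is nonzero. For $X\subseteq R$ let $r_R(X)=\{h\in R: th=0\ \forall t\in X\}$ and $l_R(X)=\{h\in R: ht=0\ \forall t\in X\}$, and write $r_R(f)=r_R(\{f\})$, $l_R(f)=l_R(\{f\})$. Then: 1. If some reduced word in $\operatorname{supp}(f)$ ends with the letter $x$, then $r_R(f)=0$. In particular, $r_R(g)=0$ whenever $1\in\operatorname{supp}(g)$. 2. If $r_R(f)\neq 0$, then $f\in Ra$; if moreover $f\neq 0$, then $r_R(f)=r_R(a^k)$ for some integer $k\ge 1$. 3. If $f\neq 0$ and $l_R(f)\neq 0$, then $a^kf=0$ for some integer $k\ge 1$, and if $n$ is the smallest such integer, then $l_R(f)=Ra^n$. 4. The set of left zero divisors $\{s\in R: r_R(s)\ne 0\}$ equals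 $Ra$, and the set of right zero divisors $\{s\in R: l_R(s)\neq 0\}$ equals $\bigcup_{n\ge 1} r_R(a^n)$. 5. $R$ satisfies the ascending chain condition on left annihilators of subsets: if $l_R(X_0)\subseteq l_R(X_1)\subseteq\cdots$ with all $X_i\subseteq R$, then there is $N$ with $l_R(X_n)=l_R(X_N)$ for all $n\ge N$. -/

import Mathlib

/-! ### One-sided annihilators in a noncommutative ring -/

/-- The left annihilator `l_S(X) = {s : S | s * t = 0 for all t ∈ X}`, a left ideal
(`Ideal S` is the type of left ideals of `S`). -/
def leftAnn {S : Type*} [Ring S] (X : Set S) : Ideal S where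
  carrier := {s | ∀ t ∈ X, s * t = 0}
  add_mem' := by
    intro u v hu hv t ht
    rw [add_mul, hu t ht, hv t ht, add_zero]
  zero_mem' := by
    intro t _
    exact zero_mul t
  smul_mem' := by
    intro c u hu t ht
    rw [smul_eq_mul, mul_assoc, hu t ht, mul_zero]

/-- The right annihilator `r_S(X) = {s : S | t * s = 0 for all t ∈ X}`, a right ideal,
that is, a submodule over the opposite ring. -/
def rightAnn {S : Type*} [Ring S] (X : Set S) : Submodule Sᵐᵒᵖ S where
  carrier := {s | ∀ t ∈ X, t * s = 0}
  add_mem' := by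
    intro u v hu hv t ht
    rw [mul_add, hu t ht, hv t ht, add_zero]
  zero_mem' := by
    intro t _
    exact mul_zero t
  smul_mem' := by
    intro c u hu t ht
    rw [MulOpposite.smul_eq_mul_unop, ← mul_assoc, hu t ht, zero_mul]

namespace DK

/-! ### The ring `R = 𝔽₂⟨a, x : a = a²x⟩` -/

/-- The two letters. -/
inductive Gen where
  | a : Gen
  | x : Gen

/-- The single defining relation `a = a²x` on the free algebra `𝔽₂⟨a, x⟩`. -/
inductive Rel : FreeAlgebra (ZMod 2) Gen → FreeAlgebra (ZMod 2) Gen → Prop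
  | rel : Rel (FreeAlgebra.ι (ZMod 2) Gen.a)
      (FreeAlgebra.ι (ZMod 2) Gen.a ^ 2 * FreeAlgebra.ι (ZMod 2) Gen.x)

/-- The ring `R = 𝔽₂⟨a, x : a = a²x⟩`. -/
abbrev R : Type := RingQuot Rel

/-- The image in `R` of a letter. -/
noncomputable def gen (g : Gen) : R :=
  RingQuot.mkAlgHom (ZMod 2) Rel (FreeAlgebra.ι (ZMod 2) g)

/-- The element `a` of `R`. -/
noncomputable def a : R := gen Gen.a

/-- The element `x` of `R`. -/
noncomputable def x : R := gen Gen.x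

/-- The element of `R` represented by a word (the product of its letters, from left to right). -/
noncomputable def mon (w : List Gen) : R := (w.map gen).prod

/-- A word is reduced if `aax` does not occur in it as a block of consecutive letters. -/
def IsReduced (w : List Gen) : Prop := ¬ [Gen.a, Gen.a, Gen.x] <:+: w

/-- The reduced words. -/
abbrev ReducedWord : Type := {w : List Gen // IsReduced w}

/-! ### The reduced monomials form a basis of `R` -/

theorem a_eq : a = a ^ 2 * x := by
  have h := RingQuot.mkAlgHom_rel (ZMod 2) Rel.rel
  simpa [a, x, gen] using h

/-- The reduced form of the product of the letter `a` with a reduced word. -/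
def lmulA : List Gen → List Gen
  | Gen.a :: Gen.x :: w => lmulA w
  | w => Gen.a :: w

/-- The reduced form of the product of a letter with a reduced word. -/
def lmul : Gen → List Gen → List Gen
  | Gen.a, w => lmulA w
  | Gen.x, w => Gen.x :: w

theorem mon_nil : mon [] = 1 := rfl

theorem mon_cons (g : Gen) (w : List Gen) : mon (g :: w) = gen g * mon w := by
  simp [mon]

theorem mon_lmulA (w : List Gen) : mon (lmulA w) = a * mon w := by
  induction w using lmulA.induct with
  | case1 w ih =>
    rw [lmulA, ih, mon_cons, mon_cons]
    change a * mon w = a * (a * (x * mon w))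
    conv_lhs => rw [a_eq]
    simp only [pow_two, mul_assoc]
  | case2 w h =>
    rw [lmulA.eq_2 _ h, mon_cons]
    rfl

theorem mon_lmul (g : Gen) (w : List Gen) : mon (lmul g w) = gen g * mon w := by
  cases g with
  | a => exact mon_lmulA w
  | x => exact mon_cons _ _

theorem isReduced_nil : IsReduced [] := by
  simp [IsReduced]

theorem IsReduced.of_cons {g : Gen} {w : List Gen} (h : IsReduced (g :: w)) : IsReduced w :=
  fun h' => h (h'.trans (List.suffix_cons g w).isInfix)

theorem isReduced_lmulA (w : List Gen) (hw : IsReduced w) : IsReduced (lmulA w) := by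
  induction w using lmulA.induct with
  | case1 w ih => exact ih hw.of_cons.of_cons
  | case2 w h =>
    rw [lmulA.eq_2 _ h]
    intro h'
    rcases List.infix_cons_iff.1 h' with h' | h'
    · obtain ⟨t, ht⟩ := h'
      simp only [List.cons_append, List.nil_append, List.cons.injEq, true_and] at ht
      exact h t ht.symm
    · exact hw h'

theorem isReduced_lmul (g : Gen) (w : List Gen) (hw : IsReduced w) : IsReduced (lmul g w) := by
  cases g with
  | a => exact isReduced_lmulA w hw
  | x =>
    intro h'
    rcases List.infix_cons_iff.1 h' with h' | h'
    · obtain ⟨t, ht⟩ := h'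
      simp at ht
    · exact hw h'

theorem lmul_of_isReduced (g : Gen) (w : List Gen) (h : IsReduced (g :: w)) :
    lmul g w = g :: w := by
  cases g with
  | a =>
    refine lmulA.eq_2 w ?_
    rintro v rfl
    exact h ⟨[], v, rfl⟩
  | x => rfl

/-- `R` acts on the free vector space on all words through `lmul`. -/
noncomputable def act : R →ₐ[ZMod 2] Module.End (ZMod 2) (List Gen →₀ ZMod 2) :=
  RingQuot.liftAlgHom (ZMod 2)
    ⟨FreeAlgebra.lift (ZMod 2) (fun g => Finsupp.lmapDomain (ZMod 2) (ZMod 2) (lmul g)), by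
      rintro _ _ ⟨⟩
      ext w : 2
      simp [pow_two, Finsupp.mapDomain_single, lmul, lmulA]⟩

theorem act_gen (g : Gen) (w : List Gen) :
    act (gen g) (Finsupp.single w 1) = Finsupp.single (lmul g w) 1 := by
  simp [act, gen, Finsupp.mapDomain_single]

theorem act_mon (w : List Gen) (hw : IsReduced w) :
    act (mon w) (Finsupp.single [] 1) = Finsupp.single w 1 := by
  induction w with
  | nil => simp [mon_nil]
  | cons g w ih =>
    rw [mon_cons, map_mul, Module.End.mul_apply, ih hw.of_cons, act_gen, lmul_of_isReduced g w hw]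

theorem linearIndependent_mon :
    LinearIndependent (ZMod 2) (fun w : ReducedWord => mon w.1) := by
  have h1 : LinearIndependent (ZMod 2)
      (fun w : ReducedWord => (Finsupp.single w.1 1 : List Gen →₀ ZMod 2)) :=
    (Finsupp.linearIndependent_single_one (ZMod 2) (List Gen)).comp _ Subtype.val_injective
  refine LinearIndependent.of_comp
    ((LinearMap.applyₗ (Finsupp.single [] (1 : ZMod 2))).comp act.toLinearMap) ?_
  convert h1 using 1
  funext w
  exact act_mon w.1 w.2

theorem span_mon :
    ⊤ ≤ Submodule.span (ZMod 2) (Set.range (fun w : ReducedWord => mon w.1)) := by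
  set V := Submodule.span (ZMod 2) (Set.range (fun w : ReducedWord => mon w.1)) with hV
  have hgen : ∀ (g : Gen) (v : R), v ∈ V → gen g * v ∈ V := by
    intro g v hv
    induction hv using Submodule.span_induction with
    | mem v hv =>
      obtain ⟨w, rfl⟩ := hv
      exact Submodule.subset_span
        ⟨⟨lmul g w.1, isReduced_lmul g w.1 w.2⟩, mon_lmul g w.1⟩
    | zero => simp
    | add u v _ _ hu hv => rw [mul_add]; exact V.add_mem hu hv
    | smul c v _ hv => rw [mul_smul_comm]; exact V.smul_mem c hv
  have key : ∀ (p : FreeAlgebra (ZMod 2) Gen) (v : R), v ∈ V →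
      RingQuot.mkAlgHom (ZMod 2) Rel p * v ∈ V := by
    intro p
    induction p using FreeAlgebra.induction with
    | grade0 c =>
      intro v hv
      rw [AlgHom.commutes, ← Algebra.smul_def]
      exact V.smul_mem c hv
    | grade1 g => exact hgen g
    | mul p q hp hq =>
      intro v hv
      rw [map_mul, mul_assoc]
      exact hp _ (hq _ hv)
    | add p q hp hq =>
      intro v hv
      rw [map_add, add_mul]
      exact V.add_mem (hp _ hv) (hq _ hv)
  intro r _
  obtain ⟨p, rfl⟩ := RingQuot.mkAlgHom_surjective (ZMod 2) Rel r
  have h1 : (1 : R) ∈ V := Submodule.subset_span ⟨⟨[], isReduced_nil⟩, mon_nil⟩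
  simpa using key p 1 h1

/-- The `𝔽₂`-basis of `R` consisting of the reduced monomials. -/
noncomputable def reducedBasis : Module.Basis ReducedWord (ZMod 2) R :=
  Module.Basis.mk linearIndependent_mon span_mon

theorem reducedBasis_apply (w : ReducedWord) : reducedBasis w = mon w.1 := by
  simp [reducedBasis]

/-- The support of `f`: the set of the reduced monomials (given by their words) whose coefficient
in the reduced form of `f` is nonzero. -/
noncomputable def supp (f : R) : Finset ReducedWord := (reducedBasis.repr f).support

end DK

/-! Everything rests on one cancellation fact, `eq_zero_of_mul_eq_zero_of_coef`: if some word of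
`supp f` does not end in `a`, then `f * h = 0` forces `h = 0`. Reduced words not ending in `a` are
exactly the words in the blocks `x` and `ax`. Since `a ^ k * x ^ k = a * x` for `k ≥ 1`, and right
multiplication by `x` is injective, replacing `h` by `h * x ^ N` makes `h` a combination of block
products. Such an `h` is then shown to vanish by stripping blocks from the right and looking at the
longest block words of `f` (`eq_zero_of_mem_blockSpan`).

Hence any `g` outside `Ra` cancels on the left. Writing `f = g * a ^ k` with `g ∉ Ra` gives `r(f) =
r(a ^ k)`. If `g * f = 0` while `a ^ j * f ≠ 0` for all `j < n`, cancelling repeatedly gives `g ∈ R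
a ^ n` (`mem_span_a_pow_of_mul_eq_zero`). A nonzero `g` lies in only finitely many `R a ^ k`, so
every left annihilator is `0` or some `R a ^ n`, and the chain condition follows because exponents
can only decrease. -/

namespace DK

/-! ### Coefficients -/

/-- The coefficient of `f` at the word `v` (zero when `v` is not reduced). -/
noncomputable def coef (v : List Gen) : R →ₗ[ZMod 2] ZMod 2 :=
  Finsupp.lapply v ∘ₗ (LinearMap.applyₗ (Finsupp.single [] (1 : ZMod 2))).comp act.toLinearMap

theorem coef_mon (v w : List Gen) (hw : IsReduced w) :
    coef v (mon w) = Finsupp.single w (1 : ZMod 2) v := by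
  change (act (mon w) (Finsupp.single [] 1)) v = _
  rw [act_mon w hw]

theorem mon_append (v w : List Gen) : mon (v ++ w) = mon v * mon w := by
  simp [mon]

theorem mon_singleton (g : Gen) : mon [g] = gen g := by
  simp [mon]

/-- Linear maps out of `R` agree if they agree on reduced monomials. -/
theorem linearMap_ext {M : Type*} [AddCommGroup M] [Module (ZMod 2) M] {φ ψ : R →ₗ[ZMod 2] M}
    (h : ∀ w, IsReduced w → φ (mon w) = ψ (mon w)) : φ = ψ := by
  refine reducedBasis.ext fun w => ?_
  rw [reducedBasis_apply]
  exact h w.1 w.2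

theorem repr_eq_coef (f : R) (w : ReducedWord) : reducedBasis.repr f w = coef w.1 f := by
  classical
  have h : (Finsupp.lapply w ∘ₗ reducedBasis.repr.toLinearMap) = coef w.1 := by
    refine linearMap_ext fun v hv => ?_
    rw [coef_mon _ _ hv, LinearMap.comp_apply]
    have := reducedBasis.repr_self ⟨v, hv⟩
    rw [reducedBasis_apply] at this
    simp only [LinearEquiv.coe_coe, this, Finsupp.lapply_apply]
    simp only [Finsupp.single_apply, Subtype.ext_iff]
  exact LinearMap.congr_fun h f

theorem mem_supp_iff (f : R) (w : ReducedWord) : w ∈ supp f ↔ coef w.1 f ≠ 0 := by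
  rw [supp, Finsupp.mem_support_iff, repr_eq_coef]

theorem exists_coef_ne_zero {f : R} (hf : f ≠ 0) : ∃ w, IsReduced w ∧ coef w f ≠ 0 := by
  by_contra! h
  refine hf (reducedBasis.repr.map_eq_zero_iff.1 (Finsupp.ext fun w => ?_))
  rw [repr_eq_coef, h w.1 w.2]
  rfl

theorem eq_zero_of_coef {f : R} (h : ∀ w, coef w f = 0) : f = 0 := by
  by_contra hf
  obtain ⟨w, -, hw⟩ := exists_coef_ne_zero hf
  exact hw (h w)

theorem isReduced_append_a {w : List Gen} (hw : IsReduced w) : IsReduced (w ++ [Gen.a]) := by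
  intro h
  rcases List.infix_concat_iff.1 h with h | h
  · have := h.getLast (by simp)
    simp at this
  · exact hw h

theorem isReduced_append_x {w : List Gen} (hw : IsReduced w) (h2 : ¬ [Gen.a, Gen.a] <:+ w) :
    IsReduced (w ++ [Gen.x]) := by
  intro h
  rcases List.infix_concat_iff.1 h with ⟨t, ht⟩ | h
  · refine h2 ⟨t, ?_⟩
    have : (t ++ [Gen.a, Gen.a]) ++ [Gen.x] = w ++ [Gen.x] := by simpa using ht
    exact List.append_cancel_right this
  · exact hw h

theorem IsReduced.of_append {v w : List Gen} (h : IsReduced (v ++ w)) : IsReduced v :=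
  fun h' => h (h'.trans (List.prefix_append v w).isInfix)

theorem mon_aax (u : List Gen) :
    mon (u ++ [Gen.a, Gen.a]) * x = mon (u ++ [Gen.a]) := by
  have h : mon [Gen.a] = mon [Gen.a, Gen.a] * x := by
    simpa [mon, a, x, pow_two, mul_assoc] using a_eq
  rw [mon_append, mon_append, h, mul_assoc]

theorem coef_mul_a (v : List Gen) (f : R) : coef (v ++ [Gen.a]) (f * a) = coef v f := by
  classical
  have h : coef (v ++ [Gen.a]) ∘ₗ LinearMap.mulRight (ZMod 2) a = coef v := by
    refine linearMap_ext fun w hw => ?_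
    have : mon w * a = mon (w ++ [Gen.a]) := by rw [mon_append, mon_singleton]; rfl
    rw [LinearMap.comp_apply, LinearMap.mulRight_apply, this, coef_mon _ _ hw,
      coef_mon _ _ (isReduced_append_a hw)]
    simp [Finsupp.single_apply]
  exact LinearMap.congr_fun h f

theorem coef_mul_a_of_not_suffix {v : List Gen} (hv : ¬ [Gen.a] <:+ v) (f : R) :
    coef v (f * a) = 0 := by
  have h : coef v ∘ₗ LinearMap.mulRight (ZMod 2) a = 0 := by
    refine linearMap_ext fun w hw => ?_
    have : mon w * a = mon (w ++ [Gen.a]) := by rw [mon_append, mon_singleton]; rfl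
    rw [LinearMap.comp_apply, LinearMap.mulRight_apply, this,
      coef_mon _ _ (isReduced_append_a hw)]
    refine Finsupp.single_eq_of_ne ?_
    rintro rfl
    exact hv (List.suffix_append _ _)
  exact LinearMap.congr_fun h f

/-- For reduced `w`, the word `wx` is reduced unless `w = uaa`, in which case `w * x` reduces to
`ua`. That result ends in `a`, so it does not interfere with words ending in `x`. -/
theorem coef_mul_x {v : List Gen} (hv : ¬ [Gen.a, Gen.a] <:+ v) (f : R) :
    coef (v ++ [Gen.x]) (f * x) = coef v f := by
  classical
  have h : coef (v ++ [Gen.x]) ∘ₗ LinearMap.mulRight (ZMod 2) x = coef v := by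
    refine linearMap_ext fun w hw => ?_
    rw [LinearMap.comp_apply, LinearMap.mulRight_apply, coef_mon _ _ hw]
    by_cases h2 : [Gen.a, Gen.a] <:+ w
    · obtain ⟨u, rfl⟩ := h2
      rw [mon_aax, coef_mon]
      · rw [Finsupp.single_eq_of_ne, Finsupp.single_eq_of_ne]
        · rintro rfl
          exact hv (List.suffix_append _ _)
        · intro h
          have := List.append_inj_right' h rfl
          simp at this
      · have : u ++ [Gen.a, Gen.a] = (u ++ [Gen.a]) ++ [Gen.a] := by simp
        rw [this] at hw
        exact hw.of_append
    · have : mon w * x = mon (w ++ [Gen.x]) := by rw [mon_append, mon_singleton]; rfl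
      rw [this, coef_mon _ _ (isReduced_append_x hw h2)]
      simp [Finsupp.single_apply]
  exact LinearMap.congr_fun h f

theorem coef_append_a_mul_x (u : List Gen) (f : R) :
    coef (u ++ [Gen.a]) (f * x) = coef (u ++ [Gen.a, Gen.a]) f := by
  classical
  have h : coef (u ++ [Gen.a]) ∘ₗ LinearMap.mulRight (ZMod 2) x
      = coef (u ++ [Gen.a, Gen.a]) := by
    refine linearMap_ext fun w hw => ?_
    rw [LinearMap.comp_apply, LinearMap.mulRight_apply, coef_mon _ _ hw]
    by_cases h2 : [Gen.a, Gen.a] <:+ w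
    · obtain ⟨t, rfl⟩ := h2
      rw [mon_aax, coef_mon]
      · simp [Finsupp.single_apply]
      · have : t ++ [Gen.a, Gen.a] = (t ++ [Gen.a]) ++ [Gen.a] := by simp
        rw [this] at hw
        exact hw.of_append
    · have : mon w * x = mon (w ++ [Gen.x]) := by rw [mon_append, mon_singleton]; rfl
      rw [this, coef_mon _ _ (isReduced_append_x hw h2), Finsupp.single_eq_of_ne,
        Finsupp.single_eq_of_ne]
      · rintro rfl
        exact h2 (List.suffix_append _ _)
      · intro h
        have := List.append_inj_right' h rfl
        simp at this
  exact LinearMap.congr_fun h f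

theorem eq_zero_of_mul_a {f : R} (h : f * a = 0) : f = 0 :=
  eq_zero_of_coef fun w => by rw [← coef_mul_a, h, map_zero]

/-- Right multiplication by `x` is injective on reduced words: it turns `uaa` into `ua` and appends
`x` to all others, and the two kinds of image differ in their last letter. -/
theorem eq_zero_of_mul_x {f : R} (h : f * x = 0) : f = 0 := by
  refine eq_zero_of_coef fun w => ?_
  by_cases h2 : [Gen.a, Gen.a] <:+ w
  · obtain ⟨u, rfl⟩ := h2
    rw [← coef_append_a_mul_x, h, map_zero]
  · rw [← coef_mul_x h2, h, map_zero]

theorem eq_zero_of_mul_x_pow {f : R} (n : ℕ) (h : f * x ^ n = 0) : f = 0 := by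
  induction n with
  | zero => simpa using h
  | succ n ih => rw [pow_succ, ← mul_assoc] at h; exact ih (eq_zero_of_mul_x h)

theorem coef_nil_one : coef [] 1 = 1 := by
  rw [← mon_nil, coef_mon _ _ isReduced_nil, Finsupp.single_eq_same]

theorem one_ne_zero_R : (1 : R) ≠ 0 := fun h => by
  have := coef_nil_one
  rw [h, map_zero] at this
  exact zero_ne_one this

theorem a_pow_ne_zero (n : ℕ) : a ^ n ≠ 0 := by
  induction n with
  | zero => simpa using one_ne_zero_R
  | succ n ih => rw [pow_succ]; exact fun h => ih (eq_zero_of_mul_a h)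

/-! ### The free subalgebra on `x` and `a * x` -/

/-- The word in the letters `a`, `x` that spells the reversal of a word in the blocks `x`
(`false`) and `ax` (`true`). -/
def enc : List Bool → List Gen
  | [] => []
  | false :: w => enc w ++ [Gen.x]
  | true :: w => enc w ++ [Gen.a] ++ [Gen.x]

theorem not_suffix_enc (w : List Bool) : ¬ [Gen.a] <:+ enc w := by
  rintro ⟨t, ht⟩
  match w with
  | [] => simp [enc] at ht
  | false :: w =>
    have := List.append_inj_right' (show t ++ [Gen.a] = enc w ++ [Gen.x] from ht) rfl
    simp at this
  | true :: w =>
    have := List.append_inj_right'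
      (show t ++ [Gen.a] = (enc w ++ [Gen.a]) ++ [Gen.x] from ht) rfl
    simp at this

theorem not_suffix_enc₂ (w : List Bool) : ¬ [Gen.a, Gen.a] <:+ enc w :=
  fun h => not_suffix_enc w ((List.suffix_cons Gen.a [Gen.a]).trans h)

theorem not_suffix_enc_append (w : List Bool) : ¬ [Gen.a, Gen.a] <:+ enc w ++ [Gen.a] := by
  rintro ⟨t, ht⟩
  have : (t ++ [Gen.a]) ++ [Gen.a] = enc w ++ [Gen.a] := by simpa using ht
  exact not_suffix_enc w ⟨t, List.append_cancel_right this⟩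

theorem length_le_length_enc (w : List Bool) : w.length ≤ (enc w).length := by
  induction w with
  | nil => simp
  | cons b w ih => cases b <;> simp [enc] <;> omega

/-- The last letter is `x`; an `a` just before it joins its block, and as `aax` is forbidden the
remaining prefix again does not end in `a`. -/
theorem exists_enc (n : ℕ) : ∀ w : List Gen, w.length ≤ n → IsReduced w → ¬ [Gen.a] <:+ w →
    ∃ W, enc W = w := by
  induction n using Nat.strong_induction_on with
  | _ n ih =>
    intro w hn hw ha
    rcases List.eq_nil_or_concat' w with rfl | ⟨u, g, rfl⟩
    · exact ⟨[], rfl⟩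
    cases g with
    | a => exact absurd (List.suffix_append _ _) ha
    | x =>
      simp only [List.length_append, List.length_singleton] at hn
      by_cases hu : [Gen.a] <:+ u
      · obtain ⟨t, rfl⟩ := hu
        simp only [List.length_append, List.length_singleton] at hn
        have ht : ¬ [Gen.a] <:+ t := by
          rintro ⟨s, rfl⟩
          exact hw ⟨s, [], by simp⟩
        obtain ⟨W, rfl⟩ := ih t.length (by omega) t le_rfl hw.of_append.of_append ht
        exact ⟨true :: W, rfl⟩
      · obtain ⟨W, rfl⟩ := ih u.length (by omega) u le_rfl hw.of_append hu
        exact ⟨false :: W, rfl⟩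

theorem coef_enc_false_mul_x (w : List Bool) (f : R) :
    coef (enc (false :: w)) (f * x) = coef (enc w) f :=
  coef_mul_x (not_suffix_enc₂ w) f

theorem coef_enc_false_mul_ax (w : List Bool) (f : R) :
    coef (enc (false :: w)) (f * (a * x)) = 0 := by
  rw [← mul_assoc, coef_enc_false_mul_x, coef_mul_a_of_not_suffix (not_suffix_enc w)]

theorem coef_enc_true_mul_ax (w : List Bool) (f : R) :
    coef (enc (true :: w)) (f * (a * x)) = coef (enc w) f := by
  rw [← mul_assoc, enc, coef_mul_x (not_suffix_enc_append w), coef_mul_a]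

/-- The span of the products of fewer than `n` factors `x` and `a * x`. -/
noncomputable def blockSpan : ℕ → Submodule (ZMod 2) R
  | 0 => ⊥
  | n + 1 => (blockSpan n).map (LinearMap.mulRight (ZMod 2) x) ⊔
      (blockSpan n).map (LinearMap.mulRight (ZMod 2) (a * x)) ⊔ Submodule.span (ZMod 2) {1}

theorem mem_blockSpan_succ {n : ℕ} {h : R} : h ∈ blockSpan (n + 1) ↔
    ∃ u ∈ blockSpan n, ∃ v ∈ blockSpan n, ∃ c : ZMod 2, u * x + v * (a * x) + c • 1 = h := by
  simp only [blockSpan, Submodule.mem_sup, Submodule.mem_map, Submodule.mem_span_singleton,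
    LinearMap.mulRight_apply]
  constructor
  · rintro ⟨_, ⟨_, ⟨u, hu, rfl⟩, _, ⟨v, hv, rfl⟩, rfl⟩, _, ⟨c, rfl⟩, rfl⟩
    exact ⟨u, hu, v, hv, c, rfl⟩
  · rintro ⟨u, hu, v, hv, c, rfl⟩
    exact ⟨_, ⟨_, ⟨u, hu, rfl⟩, _, ⟨v, hv, rfl⟩, rfl⟩, _, ⟨c, rfl⟩, rfl⟩

theorem blockSpan_mono : Monotone blockSpan := by
  refine monotone_nat_of_le_succ fun n => ?_
  induction n with
  | zero => exact bot_le
  | succ n ih =>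
    intro h hh
    obtain ⟨u, hu, v, hv, c, rfl⟩ := mem_blockSpan_succ.1 hh
    exact mem_blockSpan_succ.2 ⟨u, ih hu, v, ih hv, c, rfl⟩

theorem one_mem_blockSpan : (1 : R) ∈ blockSpan 1 :=
  mem_blockSpan_succ.2 ⟨0, zero_mem _, 0, zero_mem _, 1, by simp⟩

theorem mul_x_mem_blockSpan {n : ℕ} {h : R} (hh : h ∈ blockSpan n) : h * x ∈ blockSpan (n + 1) :=
  mem_blockSpan_succ.2 ⟨h, hh, 0, zero_mem _, 0, by simp⟩

theorem mul_ax_mem_blockSpan {n : ℕ} {h : R} (hh : h ∈ blockSpan n) :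
    h * (a * x) ∈ blockSpan (n + 1) :=
  mem_blockSpan_succ.2 ⟨0, zero_mem _, h, hh, 0, by simp⟩

theorem mul_x_pow_mem_blockSpan {n : ℕ} {h : R} (hh : h ∈ blockSpan n) (k : ℕ) :
    h * x ^ k ∈ blockSpan (n + k) := by
  induction k with
  | zero => simpa using hh
  | succ k ih => rw [pow_succ, ← mul_assoc]; exact mul_x_mem_blockSpan ih

/-- Let `m` be the largest number of blocks of a word in `supp f` not ending in `a`. If `h` is a
combination of products of blocks, then the component of `f * h` on the words not ending in `a` is
not supported on words of fewer than `m` blocks, unless `h = 0`. -/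
theorem eq_zero_of_mem_blockSpan {f : R} {m : ℕ} {W : List Bool} (hW : W.length = m)
    (hfW : coef (enc W) f ≠ 0) (hm : ∀ w : List Bool, m < w.length → coef (enc w) f = 0)
    (n : ℕ) : ∀ h ∈ blockSpan n, (∀ w : List Bool, m ≤ w.length → coef (enc w) (f * h) = 0) →
      h = 0 := by
  suffices H : ∀ h ∈ blockSpan n, ∀ e : List Bool → ZMod 2, (∀ w, m ≤ w.length → e w = 0) →
      (∀ w, coef (enc w) (f * h) = e w) → h = 0 from
    fun h hh he => H h hh _ he fun _ => rfl
  induction n with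
  | zero => exact fun h hh _ _ _ => (Submodule.mem_bot _).1 hh
  | succ n ih =>
    intro h hh e he hfh
    obtain ⟨u, hu, v, hv, c, rfl⟩ := mem_blockSpan_succ.1 hh
    simp only [mul_add, map_add, mul_smul_comm, mul_one, map_smul, ← mul_assoc f] at hfh
    -- The coefficients at words ending in the block `x` do not see `v`. The correction from `c`
    -- vanishes because `false :: w` has more than `m` blocks.
    have hu0 : u = 0 := by
      refine ih u hu (fun w => e (false :: w) - c • coef (enc (false :: w)) f) ?_ ?_
      · intro w hw
        rw [he, hm, smul_zero, sub_zero] <;> simp <;> omega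
      · intro w
        rw [← hfh, coef_enc_false_mul_x, coef_enc_false_mul_ax]
        ring
    subst hu0
    -- This has to come after `u = 0`: a word of `f * u` ending in a single `a` yields one ending in
    -- `ax` in `f * u * x`.
    have hv0 : v = 0 := by
      refine ih v hv (fun w => e (true :: w) - c • coef (enc (true :: w)) f) ?_ ?_
      · intro w hw
        rw [he, hm, smul_zero, sub_zero] <;> simp <;> omega
      · intro w
        rw [← hfh, coef_enc_true_mul_ax]
        simp
    subst hv0
    -- Only `c • f` is left, and its coefficient at the word `W` of exactly `m` blocks must vanish.
    have hc := hfh W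
    rw [he W hW.ge] at hc
    simp only [mul_zero, zero_mul, map_zero, zero_add, smul_eq_mul, mul_eq_zero, hfW,
      or_false] at hc
    simp [hc]

theorem a_pow_succ_mul_x (k : ℕ) : a ^ (k + 2) * x = a ^ (k + 1) := by
  rw [pow_add, mul_assoc, ← a_eq, pow_succ]

/-- High powers of `x` on the right absorb a trailing power of `a` into a single block `ax`. -/
theorem a_pow_mul_x_pow (k : ℕ) : a ^ (k + 1) * x ^ (k + 1) = a * x := by
  induction k with
  | zero => simp
  | succ k ih => rw [pow_succ' x, ← mul_assoc, a_pow_succ_mul_x, ih]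

/-- Every element is a sum of terms `s * a ^ k` with `s` a combination of products of blocks. -/
theorem mem_span_block_mul_pow (h : R) :
    h ∈ Submodule.span (ZMod 2) {t : R | ∃ n, ∃ s ∈ blockSpan n, ∃ k : ℕ, t = s * a ^ k} := by
  set D := Submodule.span (ZMod 2) {t : R | ∃ n, ∃ s ∈ blockSpan n, ∃ k : ℕ, t = s * a ^ k}
    with hD
  have hgen : ∀ (g : Gen) (t : R), t ∈ D → t * gen g ∈ D := by
    intro g t ht
    induction ht using Submodule.span_induction with
    | mem t ht =>
      obtain ⟨n, s, hs, k, rfl⟩ := ht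
      apply Submodule.subset_span
      cases g with
      | a => exact ⟨n, s, hs, k + 1, by rw [pow_succ, ← mul_assoc]; rfl⟩
      | x =>
        change ∃ m, ∃ r ∈ blockSpan m, ∃ j : ℕ, s * a ^ k * x = r * a ^ j
        match k with
        | 0 => exact ⟨n + 1, s * x, mul_x_mem_blockSpan hs, 0, by simp⟩
        | 1 => exact ⟨n + 1, s * (a * x), mul_ax_mem_blockSpan hs, 0, by simp [mul_assoc]⟩
        | k + 2 => exact ⟨n, s, hs, k + 1, by rw [mul_assoc, a_pow_succ_mul_x]⟩
    | zero => simp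
    | add u v _ _ hu hv => rw [add_mul]; exact D.add_mem hu hv
    | smul c v _ hv => rw [smul_mul_assoc]; exact D.smul_mem c hv
  have hmon : ∀ w : List Gen, mon w ∈ D := by
    intro w
    induction w using List.reverseRecOn with
    | nil => exact Submodule.subset_span ⟨1, 1, one_mem_blockSpan, 0, by simp [mon_nil]⟩
    | append_singleton w g ih => rw [mon_append, mon_singleton]; exact hgen g _ ih
  refine Submodule.span_le.2 ?_ (span_mon (Submodule.mem_top (x := h)))
  rintro _ ⟨w, rfl⟩
  exact hmon w.1

/-- Asking for all `M ≥ N` lets the summands of `h` share a common exponent. -/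
theorem exists_mul_x_pow_mem (h : R) : ∃ N, ∀ M, N ≤ M → ∃ n, h * x ^ M ∈ blockSpan n := by
  induction mem_span_block_mul_pow h using Submodule.span_induction with
  | mem t ht =>
    obtain ⟨n, s, hs, k, rfl⟩ := ht
    refine ⟨k, fun M hM => ?_⟩
    obtain ⟨j, rfl⟩ := Nat.exists_eq_add_of_le hM
    match k with
    | 0 => exact ⟨_, by simpa using mul_x_pow_mem_blockSpan hs (0 + j)⟩
    | k + 1 =>
      refine ⟨n + 1 + j, ?_⟩
      rw [pow_add x, mul_assoc, ← mul_assoc (a ^ _), a_pow_mul_x_pow, ← mul_assoc]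
      exact mul_x_pow_mem_blockSpan (mul_ax_mem_blockSpan hs) j
  | zero => exact ⟨0, fun M _ => ⟨0, by simp⟩⟩
  | add u v _ _ hu hv =>
    obtain ⟨N, hN⟩ := hu
    obtain ⟨N', hN'⟩ := hv
    refine ⟨max N N', fun M hM => ?_⟩
    obtain ⟨n, hn⟩ := hN M (le_of_max_le_left hM)
    obtain ⟨n', hn'⟩ := hN' M (le_of_max_le_right hM)
    refine ⟨max n n', ?_⟩
    rw [add_mul]
    exact add_mem (blockSpan_mono (le_max_left _ _) hn) (blockSpan_mono (le_max_right _ _) hn')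
  | smul c v _ hv =>
    obtain ⟨N, hN⟩ := hv
    refine ⟨N, fun M hM => ?_⟩
    obtain ⟨n, hn⟩ := hN M hM
    exact ⟨n, by rw [smul_mul_assoc]; exact Submodule.smul_mem _ c hn⟩

theorem eq_zero_of_mul_eq_zero_of_coef {f h : R} {w : List Gen} (hw : IsReduced w)
    (hwa : ¬ [Gen.a] <:+ w) (hf : coef w f ≠ 0) (hfh : f * h = 0) : h = 0 := by
  obtain ⟨W, rfl⟩ := exists_enc _ w le_rfl hw hwa
  set A : Set ℕ := {m | ∃ V : List Bool, V.length = m ∧ coef (enc V) f ≠ 0} with hA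
  have hred : ∀ v, coef v f ≠ 0 → IsReduced v := by
    intro v hv
    by_contra hr
    refine hv ?_
    have : coef v = 0 := by
      refine linearMap_ext fun u hu => ?_
      rw [coef_mon _ _ hu]
      exact Finsupp.single_eq_of_ne fun h => hr (h ▸ hu)
    rw [this, LinearMap.zero_apply]
  have hbdd : BddAbove A := by
    refine ⟨(supp f).sup fun v => v.1.length, ?_⟩
    rintro _ ⟨V, rfl, hV⟩
    have hmem : (⟨enc V, hred _ hV⟩ : ReducedWord) ∈ supp f := (mem_supp_iff _ _).2 hV
    exact (length_le_length_enc V).trans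
      (Finset.le_sup (f := fun v : ReducedWord => v.1.length) hmem)
  -- `V` has the largest number of blocks among the words of `supp f` not ending in `a`.
  obtain ⟨V, hV, hVf⟩ := Nat.sSup_mem (s := A) ⟨_, W, rfl, hf⟩ hbdd
  obtain ⟨N, hN⟩ := exists_mul_x_pow_mem h
  obtain ⟨n, hn⟩ := hN N le_rfl
  refine eq_zero_of_mul_x_pow N (eq_zero_of_mem_blockSpan hV hVf ?_ n _ hn ?_)
  · intro v hv
    by_contra hne
    exact absurd (le_csSup hbdd ⟨v, rfl, hne⟩) (not_le.2 hv)
  · intro v _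
    rw [← mul_assoc, hfh, zero_mul, map_zero]

/-! ### Divisibility by powers of `a` -/

theorem mem_span_a_of_coef {f : R} (h : ∀ w, IsReduced w → coef w f ≠ 0 → [Gen.a] <:+ w) :
    f ∈ Ideal.span {a} := by
  rw [← reducedBasis.linearCombination_repr f, Finsupp.linearCombination_apply]
  refine Submodule.sum_mem _ fun w hw => ?_
  obtain ⟨u, hu⟩ := h w.1 w.2 ((mem_supp_iff f w).1 hw)
  beta_reduce
  rw [reducedBasis_apply, ← hu, mon_append, mon_singleton, ← smul_mul_assoc]
  exact Ideal.mem_span_singleton'.2 ⟨_, rfl⟩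

theorem eq_zero_of_notMem_span_a {f h : R} (hf : f ∉ Ideal.span {a}) (hfh : f * h = 0) :
    h = 0 := by
  by_contra hh
  refine hf (mem_span_a_of_coef fun w hw hc => ?_)
  by_contra hwa
  exact hh (eq_zero_of_mul_eq_zero_of_coef hw hwa hc hfh)

/-- A nonzero element is not divisible on the right by arbitrarily large powers of `a`. -/
theorem exists_bound_of_ne_zero {f : R} (hf : f ≠ 0) :
    ∃ B : ℕ, ∀ k g, g * a ^ k = f → k ≤ B := by
  obtain ⟨w, -, hw⟩ := exists_coef_ne_zero hf
  clear hf
  -- Each right factor `a` of `f` accounts for one trailing `a` of the word `w`.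
  refine ⟨w.length, ?_⟩
  rintro k g rfl
  induction k generalizing w with
  | zero => exact Nat.zero_le _
  | succ k ih =>
    rw [pow_succ, ← mul_assoc] at hw
    by_cases hs : [Gen.a] <:+ w
    · obtain ⟨v, rfl⟩ := hs
      rw [coef_mul_a] at hw
      have := ih v hw
      simpa using this
    · exact absurd (coef_mul_a_of_not_suffix hs _) hw

theorem exists_eq_mul_a_pow {f : R} (hf : f ≠ 0) :
    ∃ k g, g * a ^ k = f ∧ g ∉ Ideal.span {a} := by
  obtain ⟨B, hB⟩ := exists_bound_of_ne_zero hf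
  by_contra! h
  have : ∀ k : ℕ, ∃ g, g * a ^ k = f := by
    intro k
    induction k with
    | zero => exact ⟨f, by simp⟩
    | succ k ih =>
      obtain ⟨g, hg⟩ := ih
      obtain ⟨g', rfl⟩ := Ideal.mem_span_singleton'.1 (h k g hg)
      exact ⟨g', by rw [pow_succ', ← mul_assoc, hg]⟩
  obtain ⟨g, hg⟩ := this (B + 1)
  exact absurd (hB _ _ hg) (by omega)

/-- If `g = g' * a ^ j` with `g' ∉ Ra`, then cancelling `g'` in `g' * (a ^ j * f) = 0` would give `a
^ j * f = 0`. -/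
theorem mem_span_a_pow_of_mul_eq_zero {f g : R} (hgf : g * f = 0) (n : ℕ)
    (hn : ∀ j < n, a ^ j * f ≠ 0) : g ∈ Ideal.span {a ^ n} := by
  induction n with
  | zero => simp
  | succ n ih =>
    obtain ⟨g', rfl⟩ := Ideal.mem_span_singleton'.1 (ih fun j hj => hn j (by omega))
    have hg' : g' ∈ Ideal.span {a} := by
      by_contra hna
      exact hn n (by omega) (eq_zero_of_notMem_span_a hna (by rw [← mul_assoc, hgf]))
    obtain ⟨r, rfl⟩ := Ideal.mem_span_singleton'.1 hg'
    exact Ideal.mem_span_singleton'.2 ⟨r, by rw [pow_succ', mul_assoc]⟩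

theorem a_pow_mul_eq_zero_mono {f : R} {m n : ℕ} (hmn : m ≤ n) (h : a ^ m * f = 0) :
    a ^ n * f = 0 := by
  obtain ⟨k, rfl⟩ := Nat.exists_eq_add_of_le' hmn
  rw [pow_add, mul_assoc, h, mul_zero]

/-- The exponent depends on `g` alone, so it serves all `f` in a subset annihilated by `g` at once.
-/
theorem mul_eq_zero_imp_a_pow {g : R} (hg : g ≠ 0) :
    ∃ B : ℕ, ∀ f, g * f = 0 → a ^ B * f = 0 := by
  obtain ⟨B, hB⟩ := exists_bound_of_ne_zero hg
  refine ⟨B, fun f hgf => ?_⟩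
  by_contra hne
  obtain ⟨r, hr⟩ := Ideal.mem_span_singleton'.1 (mem_span_a_pow_of_mul_eq_zero hgf (B + 1)
    fun j hj h0 => hne (a_pow_mul_eq_zero_mono (by omega) h0))
  exact absurd (hB _ _ hr) (by omega)

/-! ### Annihilators -/

theorem mem_leftAnn_singleton {f h : R} : h ∈ leftAnn {f} ↔ h * f = 0 :=
  ⟨fun H => H f rfl, fun H t ht => by rw [Set.mem_singleton_iff.1 ht, H]⟩

theorem mem_rightAnn_singleton {f h : R} : h ∈ rightAnn {f} ↔ f * h = 0 :=
  ⟨fun H => H f rfl, fun H t ht => by rw [Set.mem_singleton_iff.1 ht, H]⟩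

theorem rightAnn_eq_bot_of_coef {f : R} {w : List Gen} (hw : IsReduced w)
    (hwa : ¬ [Gen.a] <:+ w) (hf : coef w f ≠ 0) : rightAnn {f} = ⊥ :=
  (Submodule.eq_bot_iff _).2 fun _ hh =>
    eq_zero_of_mul_eq_zero_of_coef hw hwa hf (mem_rightAnn_singleton.1 hh)

theorem mem_span_a_of_rightAnn_ne_bot {f : R} (hf : rightAnn {f} ≠ ⊥) : f ∈ Ideal.span {a} := by
  by_contra h
  exact hf ((Submodule.eq_bot_iff _).2 fun _ hh =>
    eq_zero_of_notMem_span_a h (mem_rightAnn_singleton.1 hh))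

theorem rightAnn_eq_rightAnn_a_pow {f : R} (hf : f ≠ 0) (hr : rightAnn {f} ≠ ⊥) :
    ∃ k : ℕ, 1 ≤ k ∧ rightAnn {f} = rightAnn {a ^ k} := by
  obtain ⟨k, g, rfl, hg⟩ := exists_eq_mul_a_pow hf
  refine ⟨k, ?_, ?_⟩
  · rcases Nat.eq_zero_or_pos k with rfl | hk
    · rw [pow_zero, mul_one] at hr
      exact absurd (mem_span_a_of_rightAnn_ne_bot hr) hg
    · exact hk
  · ext h
    rw [mem_rightAnn_singleton, mem_rightAnn_singleton, mul_assoc]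
    exact ⟨eq_zero_of_notMem_span_a hg, fun h0 => by rw [h0, mul_zero]⟩

theorem exists_a_pow_mul_eq_zero {f : R} (hl : leftAnn {f} ≠ ⊥) :
    ∃ k : ℕ, 1 ≤ k ∧ a ^ k * f = 0 := by
  obtain ⟨g, hg, hg0⟩ := Submodule.exists_mem_ne_zero_of_ne_bot hl
  obtain ⟨B, hB⟩ := mul_eq_zero_imp_a_pow hg0
  -- `B` may be `0`; the shift ensures a positive exponent.
  exact ⟨B + 1, by omega,
    a_pow_mul_eq_zero_mono (Nat.le_succ B) (hB f (mem_leftAnn_singleton.1 hg))⟩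

theorem leftAnn_eq_span_a_pow {f : R} (hf : f ≠ 0) {n : ℕ}
    (hn : IsLeast {k : ℕ | 1 ≤ k ∧ a ^ k * f = 0} n) : leftAnn {f} = Ideal.span {a ^ n} := by
  refine le_antisymm (fun g hg => ?_) ?_
  · refine mem_span_a_pow_of_mul_eq_zero (mem_leftAnn_singleton.1 hg) n fun j hj h0 => ?_
    rcases Nat.eq_zero_or_pos j with rfl | hj0
    · exact hf (by simpa using h0)
    · exact absurd (hn.2 ⟨hj0, h0⟩) (by omega)
  · rw [Ideal.span_singleton_le_iff_mem, mem_leftAnn_singleton]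
    exact hn.1.2

/-- The element `1 - a * x` witnesses that all of `Ra` consists of left zero divisors. -/
theorem a_mul_one_sub : a * (1 - a * x) = 0 := by
  rw [mul_sub, mul_one, ← mul_assoc, ← pow_two, ← a_eq, sub_self]

theorem one_sub_ax_ne_zero : 1 - a * x ≠ 0 := by
  intro h
  have hm : mon [Gen.a, Gen.x] = a * x := by simp [mon, a, x]
  have hr : IsReduced [Gen.a, Gen.x] := fun h => by simpa using h.length_le
  have := congrArg (coef []) h
  rw [map_sub, coef_nil_one, ← hm, coef_mon _ _ hr, Finsupp.single_eq_of_ne (by simp),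
    map_zero, sub_zero] at this
  exact one_ne_zero this

theorem rightAnn_ne_bot_iff {f : R} : rightAnn {f} ≠ ⊥ ↔ f ∈ Ideal.span {a} := by
  refine ⟨mem_span_a_of_rightAnn_ne_bot, fun h hb => ?_⟩
  obtain ⟨g, rfl⟩ := Ideal.mem_span_singleton'.1 h
  refine one_sub_ax_ne_zero ((Submodule.eq_bot_iff _).1 hb _ (mem_rightAnn_singleton.2 ?_))
  rw [mul_assoc, a_mul_one_sub, mul_zero]

theorem leftAnn_ne_bot_iff {f : R} : leftAnn {f} ≠ ⊥ ↔ ∃ n : ℕ, 1 ≤ n ∧ a ^ n * f = 0 := by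
  refine ⟨exists_a_pow_mul_eq_zero, ?_⟩
  rintro ⟨n, -, hn⟩ hb
  exact a_pow_ne_zero n ((Submodule.eq_bot_iff _).1 hb _ (mem_leftAnn_singleton.2 hn))

theorem leftAnn_eq_bot_or (X : Set R) : leftAnn X = ⊥ ∨ ∃ n : ℕ, leftAnn X = Ideal.span {a ^ n} := by
  classical
  refine or_iff_not_imp_left.2 fun hX => ?_
  obtain ⟨g, hg, hg0⟩ := Submodule.exists_mem_ne_zero_of_ne_bot hX
  obtain ⟨B, hB⟩ := mul_eq_zero_imp_a_pow hg0
  have hex : ∃ n : ℕ, a ^ n ∈ leftAnn X := ⟨B, fun t ht => hB t (hg t ht)⟩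
  refine ⟨Nat.find hex, le_antisymm (fun h hh => ?_)
    ((Ideal.span_singleton_le_iff_mem _).2 (Nat.find_spec hex))⟩
  rcases hk : Nat.find hex with _ | k
  · simp
  · have hnot : ¬ a ^ k ∈ leftAnn X := Nat.find_min hex (by omega)
    -- With `k + 1` the least exponent for `X`, a single `t` already survives `a ^ k`, hence all
    -- lower powers, so the one-element criterion applies to it.
    have : ∃ t ∈ X, a ^ k * t ≠ 0 := by
      by_contra! H
      exact hnot H
    obtain ⟨t, ht, hne⟩ := this
    exact mem_span_a_pow_of_mul_eq_zero (hh t ht) (k + 1)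
      fun j hj h0 => hne (a_pow_mul_eq_zero_mono (by omega) h0)

/-- Let `k` be the least exponent with `a ^ k` in some member of the chain, say the `N`th. A later
nonzero member is `R a ^ j` with `j ≥ k`, hence lies in `R a ^ k` and so in the `N`th member. -/
theorem leftAnn_chain_stabilizes (X : ℕ → Set R)
    (hX : ∀ n, leftAnn (X n) ≤ leftAnn (X (n + 1))) :
    ∃ N, ∀ n, N ≤ n → leftAnn (X n) = leftAnn (X N) := by
  classical
  have hmono : Monotone fun n => leftAnn (X n) := monotone_nat_of_le_succ hX
  by_cases hex : ∃ k : ℕ, ∃ N, a ^ k ∈ leftAnn (X N)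
  · obtain ⟨N, hN⟩ := Nat.find_spec hex
    refine ⟨N, fun n hn => le_antisymm ?_ (hmono hn)⟩
    rcases leftAnn_eq_bot_or (X n) with h | ⟨j, hj⟩
    · exact h.trans_le bot_le
    · have hjn : a ^ j ∈ leftAnn (X n) := hj ▸ Ideal.mem_span_singleton_self _
      obtain ⟨i, hi⟩ := Nat.exists_eq_add_of_le' (Nat.find_min' hex ⟨n, hjn⟩)
      rw [hj, Ideal.span_singleton_le_iff_mem, hi, pow_add]
      exact Ideal.mul_mem_left _ _ hN
  · have hbot : ∀ n, leftAnn (X n) = ⊥ := fun n =>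
      (leftAnn_eq_bot_or (X n)).resolve_right fun ⟨k, hk⟩ =>
        hex ⟨k, n, hk ▸ Ideal.mem_span_singleton_self _⟩
    exact ⟨0, fun n _ => by rw [hbot, hbot]⟩

end DK

theorem theorem3p2 :
    -- a reduced monomial ending in the letter `x` in the support forces `r_R(f) = 0`
    (∀ f : DK.R, (∃ w ∈ DK.supp f, [DK.Gen.x] <:+ w.1) → rightAnn {f} = ⊥) ∧
    -- so does the monomial `1`
    (∀ g : DK.R, (∃ w ∈ DK.supp g, w.1 = []) → rightAnn {g} = ⊥) ∧
    -- right annihilators of elements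
    (∀ f : DK.R, rightAnn {f} ≠ ⊥ → f ∈ Ideal.span {DK.a}) ∧
    (∀ f : DK.R, f ≠ 0 → rightAnn {f} ≠ ⊥ →
      ∃ k : ℕ, 1 ≤ k ∧ rightAnn {f} = rightAnn {DK.a ^ k}) ∧
    -- left annihilators of elements
    (∀ f : DK.R, f ≠ 0 → leftAnn {f} ≠ ⊥ →
      (∃ k : ℕ, 1 ≤ k ∧ DK.a ^ k * f = 0) ∧
      ∀ n : ℕ, IsLeast {k : ℕ | 1 ≤ k ∧ DK.a ^ k * f = 0} n →
        leftAnn {f} = Ideal.span {DK.a ^ n}) ∧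
    -- left zero divisors
    {s : DK.R | rightAnn {s} ≠ ⊥} = (Ideal.span {DK.a} : Ideal DK.R) ∧
    -- right zero divisors
    {s : DK.R | leftAnn {s} ≠ ⊥} =
      ⋃ (n : ℕ) (_ : 1 ≤ n), (rightAnn {DK.a ^ n} : Set DK.R) ∧
    -- ascending chain condition on left annihilators of subsets
    (∀ X : ℕ → Set DK.R, (∀ n, leftAnn (X n) ≤ leftAnn (X (n + 1))) →
      ∃ N, ∀ n, N ≤ n → leftAnn (X n) = leftAnn (X N)) := by
  refine ⟨?_, ?_, fun f => DK.mem_span_a_of_rightAnn_ne_bot,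
    fun f => DK.rightAnn_eq_rightAnn_a_pow,
    fun f hf hl => ⟨DK.exists_a_pow_mul_eq_zero hl, fun n => DK.leftAnn_eq_span_a_pow hf⟩,
    ?_, ?_, DK.leftAnn_chain_stabilizes⟩
  · rintro f ⟨w, hw, hx⟩
    refine DK.rightAnn_eq_bot_of_coef w.2 (fun ha => ?_) ((DK.mem_supp_iff f w).1 hw)
    obtain ⟨t, ht⟩ := hx
    obtain ⟨s, hs⟩ := ha
    have := List.append_inj_right' (hs.trans ht.symm) rfl
    simp at this
  · rintro g ⟨w, hw, h1⟩
    exact DK.rightAnn_eq_bot_of_coef w.2 (by simp [h1]) ((DK.mem_supp_iff g w).1 hw)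
  · ext f
    exact DK.rightAnn_ne_bot_iff
  · ext f
    simp only [Set.mem_ofPred_eq, DK.leftAnn_ne_bot_iff, Set.mem_iUnion, SetLike.mem_coe,
      DK.mem_rightAnn_singleton, exists_prop]
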